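/- Let $M=\{A,B,C\}$ and let $V$ be the set of injective functions $u:M\to[0,1]$ with $0$ and $1$ in their image. For $n\ge 1$, a mechanism for $n$ voters is a map $J$ from $V^n$ to the set of probability distributions on $M$. Its approximation ratio is \[ \mathrm{ratio}(J)=\inf_{\mathbf u\in V^n}\frac{\mathbb E_{j\sim J(\mathbf u)}\bigl[\sum_{i=1}^n u_i(j)\bigr]}{\max_{j\in M}\sum_{i=1}^n u_i(j)}. \] $J$ is truthful if $\mathbb E[u_i(J(u_i,u_{-i}))]\ge \mathbb E[u_i(J(v,u_{-i}))]$ for every voter $i$, every $\mathbf u\in V^n$ and every $v\in V$; it is ordinal if $J(u_i,u_{-i})=J(v,u_{-i})$ whenever $u_i$ and $v$ induce the same ranking of $M$. Random-favorite selects a voter uniformly at random and elects his most preferred candidate. Quadratic-lottery $Q_n$ selects one of the $n$ voters uniformly at random and, with $\alpha$ his valuation of his second most preferred candidate, elects his most, second most and least preferred candidate with probability $(4-\alpha^2)/6$, $(1+2\alpha)/6$ and $(1-2\alpha+\alpha^2)/6$, respectively. Let $J_n$ be the mechanism for $n$ voters that runs random-favorite with probability $29/100$ and $Q_n$ with probability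 $71/100$. Then: 1. $\lim_{n\to\infty}\mathrm{ratio}(Q_n)=\frac{\sqrt5-1}{2}$. 2. For every $n\ge1$, $J_n$ is truthful and $\mathrm{ratio}(J_n)>\frac{33}{50}=0.660$. 3. Consequently $J_n$ beats all truthful ordinal mechanisms when there are sufficiently many voters: there are $\delta>0$ and $N$ such that for every $n\ge N$ and every truthful ordinal mechanism $J$ for $n$ voters, $\mathrm{ratio}(J)+\delta\le\mathrm{ratio}(J_n)$. -/

import Mathlib

open Filter Topology

noncomputable section

namespace Voting

/-- Canonically represented valuation functions on `m` candidates: injective functions into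
`[0,1]` with both `0` and `1` in the image. -/
def Valuation (m : ℕ) : Type :=
  {u : Fin m → ℝ // Function.Injective u ∧ (∀ j, u j ∈ Set.Icc (0 : ℝ) 1) ∧
    0 ∈ Set.range u ∧ 1 ∈ Set.range u}

instance (m : ℕ) : CoeFun (Valuation m) (fun _ => Fin m → ℝ) := ⟨Subtype.val⟩

/-- A valuation profile of `n` voters. -/
abbrev Profile (m n : ℕ) : Type := Fin n → Valuation m

/-- Lotteries (probability vectors) on the `m` candidates. -/
abbrev Lottery (m : ℕ) : Type := stdSimplex ℝ (Fin m)

/-- A randomized mechanism, viewed as a map from profiles to lotteries. -/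
abbrev Mechanism (m n : ℕ) : Type := Profile m n → Lottery m

/-- The expected value of the function `w` on candidates under the lottery `p`. -/
def expect {m : ℕ} (p : Lottery m) (w : Fin m → ℝ) : ℝ := ∑ j, p.1 j * w j

/-- The social welfare of candidate `j`. -/
def welfare {m n : ℕ} (u : Profile m n) (j : Fin m) : ℝ := ∑ i, u i j

/-- The approximation ratio: infimum over all profiles of expected social welfare divided by
the optimal social welfare. -/
def ratio {m n : ℕ} (J : Mechanism m n) : ℝ :=
  ⨅ u : Profile m n, expect (J u) (welfare u) / ⨆ j : Fin m, welfare u j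

/-- Truthfulness in expectation. -/
def Truthful {m n : ℕ} (J : Mechanism m n) : Prop :=
  ∀ (i : Fin n) (u : Profile m n) (v : Valuation m),
    expect (J (Function.update u i v)) (u i) ≤ expect (J u) (u i)

/-- Ordinal mechanisms: the lottery does not change if a voter replaces his valuation by one that
ranks the candidates in the same way. -/
def Ordinal {m n : ℕ} (J : Mechanism m n) : Prop :=
  ∀ (i : Fin n) (u : Profile m n) (v : Valuation m),
    (∀ j k, u i j < u i k ↔ v j < v k) → J (Function.update u i v) = J u

/-- The position of candidate `j` on the ballot `u`: the number of candidates that are strictly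
preferred to `j`. So `0` is the most preferred candidate, `1` the second most preferred one. -/
def position {m : ℕ} (u : Valuation m) (j : Fin m) : ℕ :=
  (Finset.univ.filter fun k => u j < u k).card

theorem position_lt {m : ℕ} (u : Valuation m) (j : Fin m) : position u j < m := by
  have h : (Finset.univ.filter fun k => u j < u k).card < (Finset.univ : Finset (Fin m)).card :=
    Finset.card_lt_card (Finset.filter_ssubset.2 ⟨j, Finset.mem_univ j, lt_irrefl _⟩)
  simpa [position] using h

theorem position_lt_position {m : ℕ} (u : Valuation m) {j k : Fin m} (h : u j < u k) :
    position u k < position u j := by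
  refine Finset.card_lt_card (Finset.ssubset_iff_of_subset ?_ |>.2 ⟨k, ?_, ?_⟩)
  · intro l hl
    simp only [Finset.mem_filter, Finset.mem_univ, true_and] at hl ⊢
    exact h.trans hl
  · simpa using h
  · simp

theorem position_injective {m : ℕ} (u : Valuation m) : Function.Injective (position u) := by
  intro j k h
  by_contra hne
  rcases lt_or_gt_of_ne (fun e => hne (u.2.1 e)) with hlt | hlt
  · exact absurd h (position_lt_position u hlt).ne'
  · exact absurd h (position_lt_position u hlt).ne

theorem sum_position {m : ℕ} (u : Valuation m) (g : ℕ → ℝ) :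
    ∑ j, g (position u j) = ∑ k ∈ Finset.range m, g k := by
  have hb : Function.Bijective (fun j => (⟨position u j, position_lt u j⟩ : Fin m)) :=
    Finite.injective_iff_bijective.1 fun j k h => position_injective u (Fin.mk.inj h)
  rw [Finset.sum_range]
  exact hb.sum_comp (fun k : Fin m => g k)

/-- Elect the candidate at position `0` of the ballot. -/
def favorite {m : ℕ} [NeZero m] (u : Valuation m) : Lottery m :=
  ⟨fun j => if position u j = 0 then 1 else 0,
    fun j => by dsimp only; split_ifs <;> norm_num,
    by
      rw [sum_position u (fun p => if p = 0 then 1 else 0)]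
      simp [NeZero.pos m]⟩

/-- The valuation of the second most preferred candidate of a ballot on three candidates
(exactly one summand has position `1`). -/
def secondValue (u : Valuation 3) : ℝ :=
  ∑ j, if position u j = 1 then u j else 0

theorem secondValue_mem (u : Valuation 3) : secondValue u ∈ Set.Icc (0 : ℝ) 1 := by
  have h := sum_position u (fun p => if p = 1 then 1 else 0)
  simp only [Finset.sum_range_succ, Finset.sum_range_zero] at h
  constructor
  · refine Finset.sum_nonneg fun j _ => ?_
    split_ifs
    exacts [(u.2.2.1 j).1, le_rfl]
  · refine le_trans (Finset.sum_le_sum fun j _ => ?_) (h.le.trans (by norm_num))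
    show (if position u j = 1 then u j else 0) ≤ if position u j = 1 then 1 else 0
    split_ifs
    exacts [(u.2.2.1 j).2, le_rfl]

/-- Probability with which the one-voter quadratic lottery elects the candidate at position `p`
when the second most preferred candidate has valuation `a`. -/
def quadraticProb (a : ℝ) (p : ℕ) : ℝ :=
  if p = 0 then (4 - a ^ 2) / 6 else if p = 1 then (1 + 2 * a) / 6 else (1 - 2 * a + a ^ 2) / 6

/-- The quadratic lottery of one ballot. -/
def quadratic (u : Valuation 3) : Lottery 3 :=
  ⟨fun j => quadraticProb (secondValue u) (position u j),
    fun j => by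
      obtain ⟨h0, h1⟩ := secondValue_mem u
      simp only [quadraticProb]
      split_ifs
      · nlinarith
      · linarith
      · nlinarith [sq_nonneg (1 - secondValue u)],
    by
      rw [sum_position u (quadraticProb (secondValue u))]
      simp only [Finset.sum_range_succ, Finset.sum_range_zero, quadraticProb]
      norm_num
      ring⟩

/-- Select a voter uniformly at random and apply the one-voter rule `L` to his ballot. -/
def randomVoter {m : ℕ} (n : ℕ) [NeZero n] (L : Valuation m → Lottery m) : Mechanism m n :=
  fun u => ⟨fun j => (∑ i, (L (u i)).1 j) / n,
    fun j => div_nonneg (Finset.sum_nonneg fun i _ => (L (u i)).2.1 j) (Nat.cast_nonneg n),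
    by
      have hn : (n : ℝ) ≠ 0 := Nat.cast_ne_zero.2 (NeZero.ne n)
      rw [← Finset.sum_div, Finset.sum_comm, Finset.sum_congr rfl fun i _ => (L (u i)).2.2]
      simp [hn]⟩

/-- Run `J` with probability `a` and `K` with probability `b`, where `a + b = 1`. -/
def mix {m n : ℕ} (a b : ℝ) (ha : 0 ≤ a) (hb : 0 ≤ b) (hab : a + b = 1) (J K : Mechanism m n) :
    Mechanism m n :=
  fun u => ⟨a • (J u).1 + b • (K u).1, convex_stdSimplex ℝ (Fin m) (J u).2 (K u).2 ha hb hab⟩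

/-- The mechanism random-favorite. -/
def randomFavorite (m n : ℕ) [NeZero m] [NeZero n] : Mechanism m n := randomVoter n favorite

/-- The mechanism quadratic-lottery for three candidates. -/
def quadraticLottery (n : ℕ) [NeZero n] : Mechanism 3 n := randomVoter n quadratic

/-- Random-favorite with probability `29/100`, quadratic-lottery with probability `71/100`. -/
def mixedMechanism (n : ℕ) [NeZero n] : Mechanism 3 n :=
  mix (29 / 100) (71 / 100) (by norm_num) (by norm_num) (by norm_num)
    (randomFavorite 3 n) (quadraticLottery n)

end Voting

end

/-!
*Lower bounds.* Against a welfare vector sorted as `w₀ ≥ w₁ ≥ w₂`, the expected welfare of the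
lottery of a single ballot is bounded below by an affine function of the ballot. Averaging over the
voters turns the ballots into the average welfares themselves, so that a polynomial inequality in
these three numbers remains.

*Upper bounds.* The ratio is an infimum, so one may pass to the limit where all voters squeeze the
valuations of their `k` favorites to `1` and those of the other candidates to `0`. For
quadratic-lottery and `k = 1` this leaves `((∑ j, p j ^ 2) / 2 + 1 / 6) / p 0`, where `p` lists the
shares of first places. For an ordinal truthful mechanism the same limit of the truthfulness
inequalities shows that the probability of a candidate depends only on the sets of candidates that
the voters rank above it. If the mechanism also treats the candidates symmetrically, which averaging
over all renamings achieves without decreasing the ratio, then the probability of the middle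
candidate is the same in all profiles made up of a ranking and its reverse. Three explicit profiles
then bound the ratio by `77 / 117 < 33 / 50` in the limit of many voters.
-/

noncomputable section

namespace Voting

open scoped BigOperators

/-! ### Ballots and one-voter rules -/

theorem Valuation.nonneg {m : ℕ} (u : Valuation m) (j : Fin m) : 0 ≤ u j := (u.2.2.1 j).1

theorem Valuation.le_one {m : ℕ} (u : Valuation m) (j : Fin m) : u j ≤ 1 := (u.2.2.1 j).2

theorem position_lt_position_iff {m : ℕ} (u : Valuation m) {j k : Fin m} :
    position u k < position u j ↔ u j < u k := by
  refine ⟨fun h => ?_, position_lt_position u⟩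
  by_contra! hle
  rcases hle.lt_or_eq with hlt | heq
  · exact (position_lt_position u hlt).asymm h
  · exact h.ne (congrArg (position u) (u.2.1 heq))

/-- The candidate at each position of the ballot `u`, as a permutation of the candidates. It is the
inverse of `position`, and sorts the candidates by decreasing valuation. -/
def candidateAt {m : ℕ} (u : Valuation m) : Equiv.Perm (Fin m) :=
  (Equiv.ofBijective (fun j => (⟨position u j, position_lt u j⟩ : Fin m))
    (Finite.injective_iff_bijective.1 fun _ _ h =>
      position_injective u (Fin.mk.inj h))).symm

theorem position_candidateAt {m : ℕ} (u : Valuation m) (k : Fin m) :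
    position u (candidateAt u k) = k :=
  congrArg Fin.val ((candidateAt u).symm_apply_apply k)

theorem strictAnti_comp_candidateAt {m : ℕ} (u : Valuation m) : StrictAnti (u ∘ candidateAt u) :=
  fun k l hkl => (position_lt_position_iff u).1 <| by
    simpa only [position_candidateAt, Fin.val_fin_lt] using hkl

theorem apply_candidateAt_zero {m : ℕ} [NeZero m] (u : Valuation m) : u (candidateAt u 0) = 1 := by
  obtain ⟨j, hj⟩ := u.2.2.2.2
  refine (u.le_one _).antisymm ?_
  have h := (strictAnti_comp_candidateAt u).antitone (Fin.zero_le ((candidateAt u).symm j))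
  rwa [Function.comp_apply, Function.comp_apply, Equiv.apply_symm_apply, hj] at h

theorem apply_candidateAt_top {m : ℕ} (u : Valuation m) {k : Fin m} (hk : IsTop k) :
    u (candidateAt u k) = 0 := by
  obtain ⟨j, hj⟩ := u.2.2.2.1
  refine le_antisymm ?_ (u.nonneg _)
  have h := (strictAnti_comp_candidateAt u).antitone (hk ((candidateAt u).symm j))
  rwa [Function.comp_apply, Function.comp_apply, Equiv.apply_symm_apply, hj] at h

theorem secondValue_eq (u : Valuation 3) : secondValue u = u (candidateAt u 1) := by
  rw [secondValue, ← Equiv.sum_comp (candidateAt u)]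
  simp [Fin.sum_univ_three, position_candidateAt]

theorem sum_valuation (v : Valuation 3) : ∑ j, v j = 1 + secondValue v := by
  rw [← Equiv.sum_comp (candidateAt v), Fin.sum_univ_three, apply_candidateAt_zero,
    apply_candidateAt_top v (k := 2) Fin.le_last, secondValue_eq, add_zero]

theorem sum_valuation_mul (v : Valuation 3) (w : Fin 3 → ℝ) :
    ∑ j, v j * w j = w (candidateAt v 0) + secondValue v * w (candidateAt v 1) := by
  rw [← Equiv.sum_comp (candidateAt v), Fin.sum_univ_three, apply_candidateAt_zero,
    apply_candidateAt_top v (k := 2) Fin.le_last, secondValue_eq, one_mul, zero_mul, add_zero]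

theorem expect_eq_sum_candidateAt {m : ℕ} (p : Lottery m) (w : Fin m → ℝ) (u : Valuation m) :
    expect p w = ∑ k, p.1 (candidateAt u k) * w (candidateAt u k) :=
  (Equiv.sum_comp (candidateAt u) fun j => p.1 j * w j).symm

theorem expect_favorite {m : ℕ} [NeZero m] (u : Valuation m) (w : Fin m → ℝ) :
    expect (favorite u) w = w (candidateAt u 0) := by
  simp [expect_eq_sum_candidateAt _ w u, favorite, position_candidateAt]

theorem expect_quadratic_eq_sum (v : Valuation 3) (w : Fin 3 → ℝ) :
    expect (quadratic v) w =
      ∑ k : Fin 3, quadraticProb (secondValue v) k * w (candidateAt v k) := by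
  simp only [expect_eq_sum_candidateAt _ w v, quadratic, position_candidateAt]

theorem expect_quadratic (v : Valuation 3) (w : Fin 3 → ℝ) :
    expect (quadratic v) w = (∑ j, v j * w j) / 2 + (1 - secondValue v) / 6 *
      (∑ j, w j + secondValue v * (w (candidateAt v 0) - w (candidateAt v 2))) := by
  rw [expect_quadratic_eq_sum, sum_valuation_mul, ← Equiv.sum_comp (candidateAt v) w]
  simp only [Fin.sum_univ_three, quadraticProb]
  norm_num
  ring

theorem expect_favorite_le {m : ℕ} [NeZero m] (u v : Valuation m) :
    expect (favorite v) u ≤ expect (favorite u) u := by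
  rw [expect_favorite, expect_favorite, apply_candidateAt_zero]
  exact u.le_one _

theorem antitone_quadraticProb {a : ℝ} (ha : a ∈ Set.Icc (0 : ℝ) 1) :
    Antitone fun k : Fin 3 => quadraticProb a k := by
  obtain ⟨h0, h1⟩ := ha
  refine Fin.antitone_iff_succ_le.2 fun k => ?_
  fin_cases k <;> norm_num [quadraticProb] <;> nlinarith

theorem sum_mul_candidateAt_le {m : ℕ} {p : Fin m → ℝ} (hp : Antitone p) (u v : Valuation m) :
    ∑ k, p k * u (candidateAt v k) ≤ ∑ k, p k * u (candidateAt u k) := by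
  have h : Monovary p (u ∘ candidateAt u) :=
    hp.monovary (strictAnti_comp_candidateAt u).antitone
  simpa using h.sum_mul_comp_perm_le_sum_mul (σ := (candidateAt v).trans (candidateAt u).symm)

theorem expect_quadratic_le (u v : Valuation 3) :
    expect (quadratic v) u ≤ expect (quadratic u) u := by
  rw [expect_quadratic_eq_sum, expect_quadratic_eq_sum]
  refine (sum_mul_candidateAt_le (antitone_quadraticProb (secondValue_mem v)) u v).trans ?_
  simp only [Fin.sum_univ_three, apply_candidateAt_zero, ← secondValue_eq,
    apply_candidateAt_top u (k := 2) Fin.le_last, quadraticProb]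
  norm_num
  nlinarith [sq_nonneg (secondValue u - secondValue v)]

theorem expect_randomVoter {m n : ℕ} [NeZero n] (L : Valuation m → Lottery m) (u : Profile m n)
    (w : Fin m → ℝ) :
    expect (randomVoter n L u) w = (∑ i, expect (L (u i)) w) / n := by
  simp only [expect, randomVoter, div_mul_eq_mul_div, Finset.sum_mul]
  rw [← Finset.sum_div, Finset.sum_comm]

theorem truthful_randomVoter {m n : ℕ} [NeZero n] {L : Valuation m → Lottery m}
    (hL : ∀ u v : Valuation m, expect (L v) u ≤ expect (L u) u) : Truthful (randomVoter n L) := by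
  intro i u v
  rw [expect_randomVoter, expect_randomVoter]
  refine div_le_div_of_nonneg_right (Finset.sum_le_sum fun k _ => ?_) (Nat.cast_nonneg n)
  obtain rfl | hk := eq_or_ne k i
  · simpa only [Function.update_self] using hL _ _
  · rw [Function.update_of_ne hk]

/-- The one-voter rule that applies `L` with probability `a` and `L'` with probability `b`, where
`a + b = 1`. -/
def mixRule {m : ℕ} (a b : ℝ) (ha : 0 ≤ a) (hb : 0 ≤ b) (hab : a + b = 1)
    (L L' : Valuation m → Lottery m) : Valuation m → Lottery m :=
  fun v => ⟨a • (L v).1 + b • (L' v).1, convex_stdSimplex ℝ (Fin m) (L v).2 (L' v).2 ha hb hab⟩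

theorem expect_mixRule {m : ℕ} {a b : ℝ} (ha : 0 ≤ a) (hb : 0 ≤ b) (hab : a + b = 1)
    (L L' : Valuation m → Lottery m) (v : Valuation m) (w : Fin m → ℝ) :
    expect (mixRule a b ha hb hab L L' v) w = a * expect (L v) w + b * expect (L' v) w := by
  simp only [expect, mixRule, Pi.add_apply, Pi.smul_apply, smul_eq_mul, add_mul, mul_assoc,
    Finset.sum_add_distrib, Finset.mul_sum]

theorem mix_randomVoter {m n : ℕ} [NeZero n] {a b : ℝ} (ha : 0 ≤ a) (hb : 0 ≤ b) (hab : a + b = 1)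
    (L L' : Valuation m → Lottery m) :
    mix a b ha hb hab (randomVoter n L) (randomVoter n L') =
      randomVoter n (mixRule a b ha hb hab L L') := by
  refine funext fun u => Subtype.ext (funext fun j => ?_)
  simp only [mix, randomVoter, mixRule, Pi.add_apply, Pi.smul_apply, smul_eq_mul,
    Finset.sum_add_distrib, ← Finset.mul_sum, add_div, mul_div_assoc]

/-- The one-voter rule that `mixedMechanism` applies to a random ballot. -/
def mixedRule : Valuation 3 → Lottery 3 :=
  mixRule (29 / 100) (71 / 100) (by norm_num) (by norm_num) (by norm_num) favorite quadratic

theorem expect_mixedRule (v : Valuation 3) (w : Fin 3 → ℝ) :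
    expect (mixedRule v) w = 29 / 100 * expect (favorite v) w + 71 / 100 * expect (quadratic v) w :=
  expect_mixRule ..

theorem mixedMechanism_eq_randomVoter (n : ℕ) [NeZero n] :
    mixedMechanism n = randomVoter n mixedRule :=
  mix_randomVoter ..

theorem truthful_mixedMechanism (n : ℕ) [NeZero n] : Truthful (mixedMechanism n) := by
  rw [mixedMechanism_eq_randomVoter]
  refine truthful_randomVoter fun u v => ?_
  rw [expect_mixedRule, expect_mixedRule]
  gcongr
  exacts [expect_favorite_le u v, expect_quadratic_le u v]

/-! ### Lower bounds -/

theorem welfare_nonneg {m n : ℕ} (u : Profile m n) (j : Fin m) : 0 ≤ welfare u j :=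
  Finset.sum_nonneg fun i _ => (u i).nonneg j

theorem welfare_le {m n : ℕ} (u : Profile m n) (j : Fin m) : welfare u j ≤ n := by
  simpa [welfare] using Finset.sum_le_card_nsmul Finset.univ _ 1 fun i _ => (u i).le_one j

theorem sum_mul_welfare {m n : ℕ} (u : Profile m n) (μ : Fin m → ℝ) :
    ∑ j, μ j * welfare u j = ∑ i, ∑ j, μ j * u i j := by
  simp only [welfare, Finset.mul_sum]
  exact Finset.sum_comm

theorem one_le_sum_valuation {m : ℕ} (v : Valuation m) : 1 ≤ ∑ j, v j := by
  obtain ⟨j, hj⟩ := v.2.2.2.2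
  exact hj.ge.trans (Finset.single_le_sum (fun k _ => v.nonneg k) (Finset.mem_univ j))

theorem le_sum_welfare {m n : ℕ} (u : Profile m n) : (n : ℝ) ≤ ∑ j, welfare u j := by
  simp only [welfare]
  rw [Finset.sum_comm]
  simpa using Finset.card_nsmul_le_sum Finset.univ _ 1 fun i _ => one_le_sum_valuation (u i)

theorem welfare_le_iSup {m n : ℕ} (u : Profile m n) (j : Fin m) :
    welfare u j ≤ ⨆ j, welfare u j :=
  le_ciSup (Set.finite_range _).bddAbove j

theorem iSup_welfare_pos {m n : ℕ} [NeZero n] (u : Profile m n) : 0 < ⨆ j, welfare u j := by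
  obtain ⟨j, hj⟩ := (u 0).2.2.2.2
  calc (0 : ℝ) < u 0 j := by rw [hj]; exact one_pos
    _ ≤ welfare u j :=
        Finset.single_le_sum (f := fun i => u i j) (fun i _ => (u i).nonneg j) (Finset.mem_univ 0)
    _ ≤ ⨆ j, welfare u j := welfare_le_iSup u j

theorem expect_nonneg {m : ℕ} (p : Lottery m) {w : Fin m → ℝ} (hw : ∀ j, 0 ≤ w j) :
    0 ≤ expect p w :=
  Finset.sum_nonneg fun j _ => mul_nonneg (p.2.1 j) (hw j)

theorem expect_const_mul {m : ℕ} (p : Lottery m) (c : ℝ) (w : Fin m → ℝ) :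
    expect p (fun j => c * w j) = c * expect p w := by
  simp only [expect, Finset.mul_sum, mul_left_comm]

theorem ratio_nonneg {m n : ℕ} (J : Mechanism m n) : 0 ≤ ratio J :=
  Real.iInf_nonneg fun u =>
    div_nonneg (expect_nonneg _ (welfare_nonneg u)) (Real.iSup_nonneg (welfare_nonneg u))

theorem ratio_mul_welfare_le {m n : ℕ} [NeZero n] (J : Mechanism m n) (u : Profile m n)
    (j : Fin m) : ratio J * welfare u j ≤ expect (J u) (welfare u) := by
  have hle : ratio J ≤ expect (J u) (welfare u) / ⨆ j, welfare u j := by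
    refine ciInf_le ⟨0, ?_⟩ u
    rintro _ ⟨v, rfl⟩
    exact div_nonneg (expect_nonneg _ (welfare_nonneg v)) (iSup_welfare_pos v).le
  calc ratio J * welfare u j ≤ ratio J * ⨆ j, welfare u j :=
        mul_le_mul_of_nonneg_left (welfare_le_iSup u j) (ratio_nonneg J)
    _ ≤ expect (J u) (welfare u) := (le_div_iff₀ (iSup_welfare_pos u)).1 hle

theorem exists_perm_antitone {m : ℕ} (w : Fin m → ℝ) :
    ∃ π : Equiv.Perm (Fin m), Antitone (w ∘ π) :=
  ⟨_, Tuple.monotone_sort (OrderDual.toDual ∘ w)⟩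

theorem apply_le_of_antitone_comp {m : ℕ} [NeZero m] {w : Fin m → ℝ} {π : Equiv.Perm (Fin m)}
    (hπ : Antitone (w ∘ π)) (j : Fin m) : w j ≤ w (π 0) := by
  simpa using hπ (Fin.zero_le (π.symm j))

theorem le_ratio {m n : ℕ} [NeZero m] [NeZero n] [Nonempty (Valuation m)] {J : Mechanism m n}
    {c : ℝ} (h : ∀ (u : Profile m n) (π : Equiv.Perm (Fin m)), Antitone (welfare u ∘ π) →
      c * welfare u (π 0) ≤ expect (J u) (welfare u)) : c ≤ ratio J := by
  refine le_ciInf fun u => ?_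
  obtain ⟨π, hπ⟩ := exists_perm_antitone (welfare u)
  have hsup : ⨆ j, welfare u j = welfare u (π 0) :=
    (welfare_le_iSup u _).antisymm' (ciSup_le (apply_le_of_antitone_comp hπ))
  rw [le_div_iff₀ (iSup_welfare_pos u), hsup]
  exact h u π hπ

theorem le_ratio_randomVoter {m n : ℕ} [NeZero m] [NeZero n] [Nonempty (Valuation m)]
    {L : Valuation m → Lottery m} {c : ℝ}
    (h : ∀ (w : Fin m → ℝ) (π : Equiv.Perm (Fin m)), Antitone (w ∘ π) → w (π 0) ≤ 1 →
      1 ≤ ∑ j, w j → ∃ (β : ℝ) (μ : Fin m → ℝ), (∀ v, β + ∑ j, μ j * v j ≤ expect (L v) w) ∧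
        c * w (π 0) ≤ β + ∑ j, μ j * w j) :
    c ≤ ratio (randomVoter n L) := by
  refine le_ratio fun u π hπ => ?_
  have hn : (0 : ℝ) < n := Nat.cast_pos.2 (NeZero.pos n)
  set w : Fin m → ℝ := fun j => welfare u j / n
  have hw : welfare u = fun j => n * w j := funext fun j => (mul_div_cancel₀ _ hn.ne').symm
  obtain ⟨β, μ, hμ, hc⟩ := h w π (fun k l hkl => div_le_div_of_nonneg_right (hπ hkl) hn.le)
    ((div_le_one hn).2 (welfare_le u _))
    (by rw [← Finset.sum_div, le_div_iff₀ hn, one_mul]; exact le_sum_welfare u)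
  calc c * welfare u (π 0) = n * (c * w (π 0)) := by rw [hw]; ring
    _ ≤ n * (β + ∑ j, μ j * w j) := by gcongr
    _ = ∑ i, (β + ∑ j, μ j * u i j) := by
        rw [Finset.sum_add_distrib, ← sum_mul_welfare, hw, mul_add, Finset.mul_sum]
        simp [mul_left_comm]
    _ ≤ ∑ i, expect (L (u i)) w := Finset.sum_le_sum fun i _ => hμ (u i)
    _ = expect (randomVoter n L u) (welfare u) := by
        rw [hw, expect_const_mul, expect_randomVoter, mul_div_cancel₀ _ hn.ne']

/-- The ballot that ranks candidate `j` in position `ρ j`, with valuations `1`, `1/2`, `0`. -/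
def ballot (ρ : Equiv.Perm (Fin 3)) : Valuation 3 :=
  ⟨fun j => 1 - (ρ j : ℝ) / 2, by
    refine ⟨fun j k hjk => ρ.injective ?_, fun j => ⟨?_, ?_⟩, ⟨ρ.symm 2, ?_⟩, ⟨ρ.symm 0, ?_⟩⟩
    · simpa [Fin.val_inj] using hjk
    · have h : ((ρ j : ℕ) : ℝ) ≤ 2 := mod_cast Fin.is_le (ρ j)
      linarith
    · exact sub_le_self _ (by positivity)
    all_goals simp⟩

theorem ballot_lt_ballot_iff (ρ : Equiv.Perm (Fin 3)) {j k : Fin 3} :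
    ballot ρ j < ballot ρ k ↔ ρ k < ρ j := by
  change 1 - (ρ j : ℝ) / 2 < 1 - (ρ k : ℝ) / 2 ↔ _
  rw [sub_lt_sub_iff_left, div_lt_div_iff_of_pos_right two_pos, Nat.cast_lt, Fin.val_fin_lt]

theorem position_ballot (ρ : Equiv.Perm (Fin 3)) (j : Fin 3) : position (ballot ρ) j = ρ j := by
  have h : (Finset.univ.filter fun k => ρ k < ρ j) = (Finset.Iio (ρ j)).map ρ.symm.toEmbedding := by
    ext k
    simp
  simp only [position, ballot_lt_ballot_iff]
  rw [h, Finset.card_map, Fin.card_Iio]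

instance : Nonempty (Valuation 3) := ⟨ballot 1⟩

theorem sum_comp_perm_three (w : Fin 3 → ℝ) (π : Equiv.Perm (Fin 3)) :
    ∑ j, w j = w (π 0) + w (π 1) + w (π 2) := by
  rw [← Equiv.sum_comp π, Fin.sum_univ_three]

theorem le_apply_of_antitone_comp {w : Fin 3 → ℝ} {π : Equiv.Perm (Fin 3)}
    (hπ : Antitone (w ∘ π)) (j : Fin 3) : w (π 2) ≤ w j := by
  simpa using hπ (Fin.le_last (π.symm j))

theorem quadratic_nonneg_of_nonneg {a b c t : ℝ} (ha : 0 < a) (hc : 0 ≤ c) (ht : 0 ≤ t)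
    (hb : b < 0 → b ^ 2 ≤ 4 * a * c) : 0 ≤ a * t ^ 2 + b * t + c := by
  rcases le_or_gt 0 b with hb0 | hb0
  · positivity
  · have h : 0 ≤ 4 * a * (a * t ^ 2 + b * t + c) := by
      linarith [sq_nonneg (2 * a * t + b), hb hb0]
    exact nonneg_of_mul_nonneg_right h (by positivity)

theorem le_expect_quadratic (v : Valuation 3) {w : Fin 3 → ℝ} {π : Equiv.Perm (Fin 3)}
    (hπ : Antitone (w ∘ π)) :
    (∑ j, v j * w j) / 2 + (∑ j, w j) / 6 - (∑ j, v j - 1) * ((2 * w (π 0) + w (π 1)) / 6) ≤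
      expect (quadratic v) w := by
  obtain ⟨ha0, ha1⟩ := secondValue_mem v
  have hspread : 0 ≤ w (candidateAt v 0) - w (candidateAt v 2) - (w (π 2) - w (π 0)) := by
    linarith [apply_le_of_antitone_comp hπ (candidateAt v 2),
      le_apply_of_antitone_comp hπ (candidateAt v 0)]
  have hx : 0 ≤ w (π 0) - w (π 2) := sub_nonneg.2 (apply_le_of_antitone_comp hπ _)
  rw [expect_quadratic, sum_valuation, sum_comp_perm_three w π]
  linarith [mul_nonneg (mul_nonneg ha0 (sub_nonneg.2 ha1)) hspread,
    mul_nonneg (mul_nonneg ha0 ha0) hx]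

/-- Equality holds at `x = √5 / 3`, `y = z`, `x + y + z = 1`. Completing the square in `y - z`
leaves a quadratic polynomial in the excess `x + y + z - 1`. -/
theorem quadratic_welfare_bound {x y z : ℝ} (hx : x ≤ 1) (hs : 1 ≤ x + y + z) :
    (√5 - 1) / 2 * x ≤ (x ^ 2 + y ^ 2 + z ^ 2) / 2 + (x + y + z) / 6
      - (x + y + z - 1) * ((2 * x + y) / 6) := by
  have h5 : √5 ^ 2 = 5 := Real.sq_sqrt (by norm_num)
  have h5u : √5 ≤ 2237 / 1000 := by
    rw [Real.sqrt_le_left (by norm_num)]; norm_num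
  have hquad : 0 ≤ 23 / 144 * (x + y + z - 1) ^ 2 + (7 / 12 - 3 / 4 * x) * (x + y + z - 1) +
      3 / 4 * (x - √5 / 3) ^ 2 := by
    refine quadratic_nonneg_of_nonneg (by norm_num) (by positivity) (by linarith) fun hb => ?_
    have hroot : 3 / 4 * x - 7 / 12 ≤ 69 / 100 * (x - √5 / 3) := by linarith
    nlinarith [pow_le_pow_left₀ (by linarith) hroot 2]
  linarith [sq_nonneg (y - z - (x + y + z - 1) / 6)]

theorem le_ratio_quadraticLottery (n : ℕ) [NeZero n] :
    (√5 - 1) / 2 ≤ ratio (quadraticLottery n) := by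
  refine le_ratio_randomVoter fun w π hπ hw1 hsum => ?_
  rw [sum_comp_perm_three w π] at hsum
  refine ⟨(∑ j, w j) / 6 + (2 * w (π 0) + w (π 1)) / 6,
    fun j => w j / 2 - (2 * w (π 0) + w (π 1)) / 6, fun v => ?_, ?_⟩
  · refine (le_of_eq ?_).trans (le_expect_quadratic v hπ)
    simp only [sum_comp_perm_three _ π]
    ring
  · refine (quadratic_welfare_bound hw1 hsum).trans (le_of_eq ?_)
    simp only [sum_comp_perm_three _ π]
    ring

theorem sum_sub_two_mul_favorite_le (v : Valuation 3) {w : Fin 3 → ℝ} {π : Equiv.Perm (Fin 3)}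
    (hπ : Antitone (w ∘ π)) :
    ∑ j, w j - 2 * w (candidateAt v 0) ≤ w (π 0) + (w (π 1) - w (π 2)) * v (π 2) := by
  have h01 : w (π 1) ≤ w (π 0) := apply_le_of_antitone_comp hπ _
  have h12 : w (π 2) ≤ w (π 1) := le_apply_of_antitone_comp hπ _
  have hv : 0 ≤ (w (π 1) - w (π 2)) * v (π 2) := mul_nonneg (sub_nonneg.2 h12) (v.nonneg _)
  have hfav := apply_candidateAt_zero v
  obtain ⟨k, hk⟩ := π.surjective (candidateAt v 0)
  rw [sum_comp_perm_three w π]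
  rw [← hk] at hfav ⊢
  fin_cases k
  · dsimp; linarith
  · dsimp; linarith
  · dsimp at hfav ⊢; rw [hfav]; linarith

theorem le_expect_mixedRule (v : Valuation 3) {w : Fin 3 → ℝ} {π : Equiv.Perm (Fin 3)}
    (hπ : Antitone (w ∘ π)) :
    645 / 1000 * ∑ j, v j * w j + 71 / 600 * ∑ j, w j
      - (∑ j, v j - 1) * (29 / 100 * w (π 0) + 71 / 600 * ∑ j, w j)
      - 71 / 2400 * (w (π 1) - w (π 2)) * v (π 2) ≤ expect (mixedRule v) w := by
  obtain ⟨ha0, ha1⟩ := secondValue_mem v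
  have hfav := sum_sub_two_mul_favorite_le v hπ
  have hsecond := mul_nonneg ha0 (sub_nonneg.2 (apply_le_of_antitone_comp hπ (candidateAt v 1)))
  have hlow : 0 ≤ (w (π 1) - w (π 2)) * v (π 2) :=
    mul_nonneg (sub_nonneg.2 (le_apply_of_antitone_comp hπ _)) (v.nonneg _)
  have ha : 0 ≤ secondValue v * (1 - secondValue v) := mul_nonneg ha0 (sub_nonneg.2 ha1)
  have ha4 : secondValue v * (1 - secondValue v) ≤ 1 / 4 := by
    linarith [sq_nonneg (secondValue v - 1 / 2)]
  rw [expect_mixedRule, expect_favorite, expect_quadratic, sum_valuation, sum_valuation_mul]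
  rw [sum_comp_perm_three w (candidateAt v)] at hfav ⊢
  linarith [mul_nonneg ha (sub_nonneg.2 hfav), mul_nonneg (sub_nonneg.2 ha4) hlow, hsecond,
    mul_nonneg ha0 hsecond]

/-- Completing the square in `y - z`, with rounded coefficients, again leaves a quadratic polynomial
in the excess `x + y + z - 1`. -/
theorem mixed_welfare_bound {x y z : ℝ} (hx : x ≤ 1) (hs : 1 ≤ x + y + z) :
    6601 / 10000 * x ≤ 645 / 1000 * (x ^ 2 + y ^ 2 + z ^ 2) + 71 / 600 * (x + y + z)
      - (x + y + z - 1) * (29 / 100 * x + 71 / 600 * (x + y + z)) - 71 / 2400 * (y - z) * z := by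
  have hquad : 0 ≤ 203996 / 1000000 * (x + y + z - 1) ^ 2
      + (64466 / 100000 - 93466 / 100000 * x) * (x + y + z - 1)
      + (96733 / 100000 * x ^ 2 - 130476 / 100000 * x + 44066 / 100000) := by
    refine quadratic_nonneg_of_nonneg (by norm_num) ?_ (by linarith) fun hb => ?_
    · nlinarith [sq_nonneg (x - 65238 / 96733)]
    · nlinarith
  nlinarith [sq_nonneg (y - z - 219 / 10000 * (y + z)), sq_nonneg (y + z), sq_nonneg (y - z)]

theorem lt_ratio_mixedMechanism (n : ℕ) [NeZero n] : 33 / 50 < ratio (mixedMechanism n) := by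
  rw [mixedMechanism_eq_randomVoter]
  refine lt_of_lt_of_le (b := 6601 / 10000) (by norm_num)
    (le_ratio_randomVoter fun w π hπ hw1 hsum => ?_)
  rw [sum_comp_perm_three w π] at hsum
  set κ := 29 / 100 * w (π 0) + 71 / 600 * ∑ j, w j with hκ
  refine ⟨71 / 600 * ∑ j, w j + κ, fun j => 645 / 1000 * w j - κ -
    if j = π 2 then 71 / 2400 * (w (π 1) - w (π 2)) else 0, fun v => ?_, ?_⟩
  · refine (le_of_eq ?_).trans (le_expect_mixedRule v hπ)
    simp only [← hκ, sub_mul, ite_mul, zero_mul, Finset.sum_sub_distrib, Finset.sum_ite_eq',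
      Finset.mem_univ, if_true, ← Finset.mul_sum, mul_assoc, mul_comm (v _)]
    ring
  · refine (mixed_welfare_bound hw1 hsum).trans (le_of_eq ?_)
    simp only [sub_mul, ite_mul, zero_mul, Finset.sum_sub_distrib, Finset.sum_ite_eq',
      Finset.mem_univ, if_true, ← Finset.mul_sum]
    simp only [hκ, sum_comp_perm_three _ π]
    ring

/-! ### The approval limit -/

theorem eq_of_forall_update {n : ℕ} {α β : Type*} {r : α → α → Prop} {F : (Fin n → α) → β}
    (h : ∀ i R b, r (R i) b → F (Function.update R i b) = F R) {R R' : Fin n → α}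
    (hR : ∀ i, r (R i) (R' i)) : F R' = F R := by
  classical
  suffices key : ∀ s : Finset (Fin n), F (s.piecewise R' R) = F R by
    simpa only [Finset.piecewise_univ] using key Finset.univ
  intro s
  induction s using Finset.induction_on with
  | empty => rw [Finset.piecewise_empty]
  | insert i s hi ih =>
    rw [Finset.piecewise_insert, h, ih]
    simpa only [Finset.piecewise_eq_of_notMem _ _ _ hi] using hR i

theorem le_at_zero_of_forall_Ioo {f g : ℝ → ℝ} (hf : Continuous f) (hg : Continuous g)
    (h : ∀ ε ∈ Set.Ioo (0 : ℝ) 1, f ε ≤ g ε) : f 0 ≤ g 0 :=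
  ContinuousWithinAt.closure_le (by rw [closure_Ioo zero_ne_one]; simp)
    hf.continuousWithinAt hg.continuousWithinAt h

/-- The indicator function of the `k` most preferred candidates on the ballot `u`. -/
def approval {m : ℕ} (k : ℕ) (u : Valuation m) (j : Fin m) : ℝ :=
  if position u j < k then 1 else 0

/-- The `k`-approval score of candidate `j`: the number of voters who rank `j` among their `k` most
preferred candidates. -/
def approvalScore {m n : ℕ} (k : ℕ) (u : Profile m n) (j : Fin m) : ℝ := ∑ i, approval k (u i) j

theorem approval_le_approval {m k : ℕ} (u : Valuation m) {j l : Fin m} (h : u j < u l) :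
    approval k u j ≤ approval k u l := by
  have hpos := position_lt_position u h
  simp only [approval]
  split_ifs
  · rfl
  · omega
  · exact zero_le_one
  · rfl

theorem approval_mem_Icc {m k : ℕ} (u : Valuation m) (j : Fin m) :
    approval k u j ∈ Set.Icc (0 : ℝ) 1 := by
  unfold approval
  split_ifs <;> simp

theorem sharpened_lt {m k : ℕ} (u : Valuation m) {ε : ℝ} (hε : ε ∈ Set.Ioo (0 : ℝ) 1)
    {j l : Fin m} (h : u j < u l) :
    (1 - ε) * approval k u j + ε * u j < (1 - ε) * approval k u l + ε * u l :=
  add_lt_add_of_le_of_lt (mul_le_mul_of_nonneg_left (approval_le_approval u h)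
    (sub_nonneg.2 hε.2.le)) (mul_lt_mul_of_pos_left h hε.1)

/-- The valuation `(1 - ε) * approval k u + ε * u`. It ranks the candidates like `u` and tends to
the `k`-approval ballot of `u`, which is not injective and hence no valuation, as `ε` tends to
`0`. -/
def sharpen {m k : ℕ} (hk : k ∈ Set.Ioo 0 m) (u : Valuation m) {ε : ℝ}
    (hε : ε ∈ Set.Ioo (0 : ℝ) 1) : Valuation m :=
  ⟨fun j => (1 - ε) * approval k u j + ε * u j, by
    have : NeZero m := ⟨(hk.1.trans hk.2).ne'⟩
    refine ⟨fun j l h => ?_, fun j => ?_, ⟨candidateAt u ⟨m - 1, Nat.pred_lt (NeZero.ne m)⟩, ?_⟩,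
      ⟨candidateAt u 0, ?_⟩⟩
    · by_contra hjl
      rcases lt_or_gt_of_ne (u.2.1.ne hjl) with hlt | hlt
      · exact (sharpened_lt u hε hlt).ne h
      · exact (sharpened_lt u hε hlt).ne' h
    · exact convex_Icc (0 : ℝ) 1 (approval_mem_Icc u j) (u.2.2.1 j) (sub_nonneg.2 hε.2.le) hε.1.le
        (sub_add_cancel 1 ε)
    · have htop : IsTop (⟨m - 1, Nat.pred_lt (NeZero.ne m)⟩ : Fin m) := fun l =>
        Fin.le_def.2 (Nat.le_pred_of_lt l.2)
      have hlast : ¬m - 1 < k := by have := hk.2; omega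
      simp only [approval, position_candidateAt, if_neg hlast, apply_candidateAt_top u htop,
        mul_zero, add_zero]
    · simp only [approval, position_candidateAt, Fin.val_zero, if_pos hk.1,
        apply_candidateAt_zero, mul_one, sub_add_cancel]⟩

section

variable {m n k : ℕ} (hk : k ∈ Set.Ioo 0 m) {ε : ℝ} (hε : ε ∈ Set.Ioo (0 : ℝ) 1)

theorem sharpen_apply (u : Valuation m) (j : Fin m) :
    sharpen hk u hε j = (1 - ε) * approval k u j + ε * u j :=
  rfl

theorem sharpen_lt_sharpen_iff (u : Valuation m) (j l : Fin m) :
    sharpen hk u hε j < sharpen hk u hε l ↔ u j < u l := by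
  refine ⟨fun h => ?_, sharpened_lt u hε⟩
  by_contra! hle
  rcases hle.lt_or_eq with hlt | heq
  · exact (sharpened_lt u hε hlt).asymm h
  · exact h.ne (congrArg (sharpen hk u hε) (u.2.1 heq).symm)

theorem welfare_sharpen (u : Profile m n) :
    welfare (fun i => sharpen hk (u i) hε) =
      fun j => (1 - ε) * approvalScore k u j + ε * welfare u j := by
  funext j
  simp only [welfare, sharpen_apply, approvalScore, Finset.sum_add_distrib, Finset.mul_sum]

end

theorem Ordinal.congr {m n : ℕ} {J : Mechanism m n} (hJ : Ordinal J) {u v : Profile m n}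
    (h : ∀ i j k, u i j < u i k ↔ v i j < v i k) : J v = J u :=
  eq_of_forall_update (r := fun x y : Valuation m => ∀ j k, x j < x k ↔ y j < y k) hJ h

theorem Ordinal.ratio_mul_approvalScore_le {m n k : ℕ} [NeZero n] {J : Mechanism m n}
    (hJ : Ordinal J) (hk : k ∈ Set.Ioo 0 m) (u : Profile m n) (x : Fin m) :
    ratio J * approvalScore k u x ≤ expect (J u) (approvalScore k u) := by
  have hle : ∀ ε ∈ Set.Ioo (0 : ℝ) 1,
      ratio J * ((1 - ε) * approvalScore k u x + ε * welfare u x) ≤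
        expect (J u) (fun j => (1 - ε) * approvalScore k u j + ε * welfare u j) := by
    intro ε hε
    have h := ratio_mul_welfare_le J (fun i => sharpen hk (u i) hε) x
    rwa [hJ.congr fun i j l => (sharpen_lt_sharpen_iff hk hε (u i) j l).symm,
      welfare_sharpen] at h
  simpa using le_at_zero_of_forall_Ioo (by fun_prop) (by unfold expect; fun_prop) hle

theorem sum_approvalScore {m n k : ℕ} (hk : k ≤ m) (u : Profile m n) :
    ∑ j, approvalScore k u j = n * k := by
  have hsum : ∀ v : Valuation m, ∑ j, approval k v j = k := fun v => by
    have hfilter : (Finset.range m).filter (· < k) = Finset.range k := by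
      ext l
      simp only [Finset.mem_filter, Finset.mem_range]
      omega
    simp only [approval]
    rw [sum_position v fun l => if l < k then 1 else 0, ← Finset.sum_filter, hfilter]
    simp
  simp only [approvalScore]
  rw [Finset.sum_comm, Finset.sum_congr rfl fun i _ => hsum (u i)]
  simp

theorem approval_ballot (k : ℕ) (ρ : Equiv.Perm (Fin 3)) (j : Fin 3) :
    approval k (ballot ρ) j = if (ρ j : ℕ) < k then 1 else 0 := by
  rw [approval, position_ballot]

theorem exists_sum_comp_eq {m n : ℕ} {t : Fin m → ℕ} (ht : ∑ j, t j = n) :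
    ∃ f : Fin n → Fin m, ∀ g : Fin m → ℝ, ∑ i, g (f i) = ∑ j, t j * g j := by
  subst ht
  refine ⟨fun i => (finSigmaFinEquiv.symm i).1, fun g => ?_⟩
  rw [Equiv.sum_comp finSigmaFinEquiv.symm fun x : (j : Fin m) × Fin (t j) => g x.1,
    Fintype.sum_sigma]
  simp

theorem exists_tendsto_natCast_div {ι : Type*} [Fintype ι] [Nonempty ι] {p : ι → ℝ}
    (hp : p ∈ stdSimplex ℝ ι) :
    ∃ t : ℕ → ι → ℕ, (∀ n, ∑ j, t n j = n) ∧
      ∀ j, Tendsto (fun n => (t n j : ℝ) / n) atTop (𝓝 (p j)) := by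
  classical
  obtain ⟨j₀⟩ := ‹Nonempty ι›
  have hfloor : ∀ n : ℕ, ∑ j, ⌊p j * n⌋₊ ≤ n := fun n => by
    have h : ∑ j, (⌊p j * n⌋₊ : ℝ) ≤ ∑ j, p j * n :=
      Finset.sum_le_sum fun j _ => Nat.floor_le (mul_nonneg (hp.1 j) n.cast_nonneg)
    rw [← Finset.sum_mul, hp.2, one_mul] at h
    exact_mod_cast h
  have htendsto : ∀ j, Tendsto (fun n : ℕ => (⌊p j * n⌋₊ : ℝ) / n) atTop (𝓝 (p j)) := fun j =>
    (tendsto_nat_floor_mul_div_atTop (hp.1 j)).comp tendsto_natCast_atTop_atTop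
  have hrest : Tendsto (fun n : ℕ => ((n - ∑ j, ⌊p j * n⌋₊ : ℕ) : ℝ) / n) atTop (𝓝 0) := by
    have h := (tendsto_const_nhds (x := (1 : ℝ))).sub
      (tendsto_finsetSum Finset.univ fun j _ => htendsto j)
    rw [hp.2, sub_self] at h
    refine h.congr' ?_
    filter_upwards [eventually_ne_atTop 0] with n hn
    rw [Nat.cast_sub (hfloor n), sub_div, div_self (Nat.cast_ne_zero.2 hn), Nat.cast_sum,
      Finset.sum_div]
  refine ⟨fun n j => ⌊p j * n⌋₊ + if j = j₀ then n - ∑ j, ⌊p j * n⌋₊ else 0, fun n => ?_,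
    fun j => ?_⟩
  · rw [Finset.sum_add_distrib, Finset.sum_ite_eq' Finset.univ, if_pos (Finset.mem_univ _),
      Nat.add_sub_cancel' (hfloor n)]
  · dsimp only
    split_ifs
    · simpa only [Nat.cast_add, add_div, add_zero] using (htendsto j).add hrest
    · simpa only [add_zero] using htendsto j

/-! ### The limit ratio of quadratic-lottery -/

theorem expect_quadratic_le_of_le (v : Valuation 3) {w : Fin 3 → ℝ} {c : ℝ} (h0 : ∀ j, 0 ≤ w j)
    (hc : ∀ j, w j ≤ c) :
    expect (quadratic v) w ≤ (∑ j, v j * w j) / 2 + (∑ j, w j) / 6 + c * (∑ j, v j - 1) / 6 := by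
  obtain ⟨ha0, ha1⟩ := secondValue_mem v
  have hspread : w (candidateAt v 0) - w (candidateAt v 2) ≤ c := by
    linarith [hc (candidateAt v 0), h0 (candidateAt v 2)]
  rw [expect_quadratic, sum_valuation]
  linarith [mul_nonneg (mul_nonneg ha0 (sub_nonneg.2 ha1)) (sub_nonneg.2 hspread),
    mul_nonneg (mul_nonneg ha0 ha0) ((h0 0).trans (hc 0)),
    mul_nonneg ha0 (Finset.sum_nonneg fun j (_ : j ∈ Finset.univ) => h0 j)]

theorem expect_quadraticLottery_mul_le {n : ℕ} [NeZero n] (u : Profile 3 n) :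
    expect (quadraticLottery n u) (welfare u) * n ≤ (∑ j, welfare u j ^ 2) / 2 +
      n * (∑ j, welfare u j) / 6 + n * (∑ j, welfare u j - n) / 6 := by
  have hn : (n : ℝ) ≠ 0 := Nat.cast_ne_zero.2 (NeZero.ne n)
  have hsq : ∑ j, welfare u j ^ 2 = ∑ i, ∑ j, u i j * welfare u j := by
    simpa only [sq, mul_comm] using sum_mul_welfare u (welfare u)
  have hone : ∑ j, welfare u j = ∑ i, ∑ j, u i j := by
    simpa using sum_mul_welfare u 1
  calc expect (quadraticLottery n u) (welfare u) * n
      = ∑ i, expect (quadratic (u i)) (welfare u) := by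
        rw [quadraticLottery, expect_randomVoter, div_mul_cancel₀ _ hn]
    _ ≤ ∑ i, ((∑ j, u i j * welfare u j) / 2 + (∑ j, welfare u j) / 6 +
          n * (∑ j, u i j - 1) / 6) := Finset.sum_le_sum fun i _ =>
        expect_quadratic_le_of_le (u i) (welfare_nonneg u) (welfare_le u)
    _ = _ := by
        rw [Finset.sum_add_distrib, Finset.sum_add_distrib, ← Finset.sum_div, ← Finset.sum_div,
          ← Finset.sum_div, ← hsq, ← Finset.mul_sum, Finset.sum_sub_distrib, ← hone]
        simp

theorem ratio_quadraticLottery_mul_plurality_le {n : ℕ} [NeZero n] (u : Profile 3 n) (x : Fin 3) :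
    ratio (quadraticLottery n) * approvalScore 1 u x * n ≤
      (∑ j, approvalScore 1 u j ^ 2) / 2 + n ^ 2 / 6 := by
  let W : ℝ → Fin 3 → ℝ := fun ε j => (1 - ε) * approvalScore 1 u j + ε * welfare u j
  have hle : ∀ ε ∈ Set.Ioo (0 : ℝ) 1, ratio (quadraticLottery n) * W ε x * n ≤
      (∑ j, W ε j ^ 2) / 2 + n * (∑ j, W ε j) / 6 + n * (∑ j, W ε j - n) / 6 := fun ε hε => by
    let v : Profile 3 n := fun i => sharpen (k := 1) (by norm_num) (u i) hε
    have hW : welfare v = W ε := welfare_sharpen _ hε u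
    rw [← hW]
    exact (mul_le_mul_of_nonneg_right (ratio_mul_welfare_le _ v x) n.cast_nonneg).trans
      (expect_quadraticLottery_mul_le v)
  have h := le_at_zero_of_forall_Ioo (by fun_prop) (by fun_prop) hle
  simp only [W, sub_zero, one_mul, zero_mul, add_zero, sum_approvalScore (show 1 ≤ 3 by norm_num),
    Nat.cast_one, mul_one, sub_self, mul_zero, zero_div] at h
  linarith

theorem ratio_quadraticLottery_mul_le {n : ℕ} [NeZero n] {t : Fin 3 → ℕ} (ht : ∑ j, t j = n)
    (x : Fin 3) :
    ratio (quadraticLottery n) * (t x / n) ≤ (∑ j, (t j / n : ℝ) ^ 2) / 2 + 1 / 6 := by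
  have hn : (0 : ℝ) < n := Nat.cast_pos.2 (NeZero.pos n)
  obtain ⟨f, hf⟩ := exists_sum_comp_eq ht
  let u : Profile 3 n := fun i => ballot (Equiv.swap 0 (f i))
  have hscore : ∀ j, approvalScore 1 u j = t j := fun j => by
    have hfav : ∀ l, approval 1 (ballot (Equiv.swap 0 l)) j = if j = l then 1 else 0 := fun l => by
      rw [approval_ballot]
      exact if_congr (by decide +revert) rfl rfl
    simp only [approvalScore, u, hfav, hf fun l => if j = l then 1 else 0]
    simp
  have h := ratio_quadraticLottery_mul_plurality_le u x
  simp only [hscore] at h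
  refine le_of_mul_le_mul_right ?_ (pow_pos hn 2)
  simp only [div_pow, ← Finset.sum_div]
  field_simp
  linarith

/-- The limiting shares of first places in the worst case for quadratic-lottery. They minimize
`((∑ j, p j ^ 2) / 2 + 1 / 6) / p 0` over the simplex. -/
def worstShares : Fin 3 → ℝ := ![√5 / 3, (1 - √5 / 3) / 2, (1 - √5 / 3) / 2]

theorem worstShares_mem_stdSimplex : worstShares ∈ stdSimplex ℝ (Fin 3) := by
  have h5 : √5 < 3 := by
    rw [Real.sqrt_lt' (by norm_num)]; norm_num
  refine ⟨fun j => ?_, ?_⟩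
  · fin_cases j <;> simp [worstShares] <;> linarith [Real.sqrt_nonneg 5]
  · simp only [worstShares, Fin.sum_univ_three, Matrix.cons_val]
    ring

theorem tendsto_ratio_quadraticLottery :
    Tendsto (fun k : ℕ => ratio (quadraticLottery (k + 1))) atTop (𝓝 ((√5 - 1) / 2)) := by
  obtain ⟨t, ht, hlim⟩ := exists_tendsto_natCast_div worstShares_mem_stdSimplex
  have hlim' : ∀ j, Tendsto (fun k => (t (k + 1) j : ℝ) / (k + 1 : ℕ)) atTop
      (𝓝 (worstShares j)) := fun j => (hlim j).comp (tendsto_add_atTop_nat 1)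
  have hp0 : 0 < worstShares 0 := by simp [worstShares]
  have hval : ((∑ j, worstShares j ^ 2) / 2 + 1 / 6) / worstShares 0 = (√5 - 1) / 2 := by
    have h5 : √5 ^ 2 = 5 := Real.sq_sqrt (by norm_num)
    rw [div_eq_iff hp0.ne', Fin.sum_univ_three]
    simp only [worstShares, Matrix.cons_val]
    linarith
  have hupper := (((tendsto_finsetSum Finset.univ fun j _ => (hlim' j).pow 2).div_const 2).add_const
    (1 / 6)).div (hlim' 0) hp0.ne'
  rw [hval] at hupper
  refine tendsto_of_tendsto_of_tendsto_of_le_of_le' tendsto_const_nhds hupper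
    (Eventually.of_forall fun k => le_ratio_quadraticLottery (k + 1)) ?_
  filter_upwards [(hlim' 0).eventually (lt_mem_nhds hp0)] with k hk
  exact (le_div_iff₀ hk).2 (ratio_quadraticLottery_mul_le (ht (k + 1)) 0)

/-! ### Ordinal truthful mechanisms -/

/-- The ballots `u` and `v` rank the same candidates above `x`. -/
def SameAbove {m : ℕ} (x : Fin m) (u v : Valuation m) : Prop := ∀ y, u x < u y ↔ v x < v y

theorem SameAbove.position_eq {m : ℕ} {x : Fin m} {u v : Valuation m} (h : SameAbove x u v) :
    position u x = position v x :=
  congrArg Finset.card (Finset.filter_congr fun y _ => h y)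

theorem SameAbove.approval_position_eq {m : ℕ} {x : Fin m} {u v : Valuation m}
    (h : SameAbove x u v) : approval (position u x) u = approval (position v x) v :=
  funext fun y => if_congr ((position_lt_position_iff u).trans
    ((h y).trans (position_lt_position_iff v).symm)) rfl rfl

theorem approval_position_succ {m : ℕ} (u : Valuation m) (x : Fin m) :
    approval (position u x + 1) u = approval (position u x) u + Pi.single x 1 := by
  funext y
  obtain rfl | hne := eq_or_ne y x
  · simp [approval]
  · have hpos : position u y ≠ position u x := (position_injective u).ne hne
    have hiff : position u y < position u x + 1 ↔ position u y < position u x := by omega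
    simp [approval, hiff, hne]

theorem apply_eq_expect_approval_sub {m : ℕ} (p : Lottery m) (u : Valuation m) (x : Fin m) :
    p.1 x = expect p (approval (position u x + 1) u) - expect p (approval (position u x) u) := by
  simp [approval_position_succ, expect, mul_add, Finset.sum_add_distrib, Pi.single_apply]

theorem approval_of_le {m k : ℕ} (hk : m ≤ k) (u : Valuation m) : approval k u = 1 :=
  funext fun j => if_pos ((position_lt u j).trans_le hk)

theorem Truthful.expect_approval_le {m n : ℕ} {J : Mechanism m n} (hT : Truthful J)
    (hJ : Ordinal J) (k : ℕ) (i : Fin n) (u : Profile m n) (v : Valuation m) :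
    expect (J (Function.update u i v)) (approval k (u i)) ≤ expect (J u) (approval k (u i)) := by
  rcases k.eq_zero_or_pos with rfl | hk0
  · simp [expect, approval]
  rcases le_or_gt m k with hkm | hkm
  · simp only [approval_of_le hkm, expect, Pi.one_apply, mul_one]
    exact ((J _).2.2.trans (J u).2.2.symm).le
  have hk : k ∈ Set.Ioo 0 m := ⟨hk0, hkm⟩
  have hle : ∀ ε ∈ Set.Ioo (0 : ℝ) 1,
      expect (J (Function.update u i v)) (fun j => (1 - ε) * approval k (u i) j + ε * u i j) ≤
        expect (J u) (fun j => (1 - ε) * approval k (u i) j + ε * u i j) := by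
    intro ε hε
    have h := hT i (Function.update u i (sharpen hk (u i) hε)) v
    rwa [Function.update_idem, Function.update_self,
      hJ i u _ fun j l => (sharpen_lt_sharpen_iff hk hε (u i) j l).symm] at h
  simpa using le_at_zero_of_forall_Ioo (by unfold expect; fun_prop) (by unfold expect; fun_prop) hle

theorem Truthful.expect_approval_eq {m n k : ℕ} {J : Mechanism m n} (hT : Truthful J)
    (hJ : Ordinal J) {i : Fin n} {u : Profile m n} {v : Valuation m}
    (h : approval k (u i) = approval k v) :
    expect (J (Function.update u i v)) (approval k v) = expect (J u) (approval k v) := by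
  have hle := hT.expect_approval_le hJ k i u v
  have hge := hT.expect_approval_le hJ k i (Function.update u i v) (u i)
  rw [Function.update_idem, Function.update_eq_self, Function.update_self] at hge
  rw [h] at hle
  exact hle.antisymm hge

theorem Truthful.apply_eq_of_sameAbove {m n : ℕ} {J : Mechanism m n} (hT : Truthful J)
    (hJ : Ordinal J) {x : Fin m} {u v : Profile m n} (h : ∀ i, SameAbove x (u i) (v i)) :
    (J v).1 x = (J u).1 x := by
  refine eq_of_forall_update (F := fun u => (J u).1 x) (fun i u v huv => ?_) h
  have hpos : approval (position v x) (u i) = approval (position v x) v := by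
    rw [← huv.approval_position_eq, huv.position_eq]
  have hsucc : approval (position v x + 1) (u i) = approval (position v x + 1) v := by
    rw [approval_position_succ v, ← hpos, ← huv.position_eq, approval_position_succ]
  simp only [apply_eq_expect_approval_sub _ v x, hT.expect_approval_eq hJ hpos,
    hT.expect_approval_eq hJ hsucc]

/-- The ballot that gives candidate `x` the valuation of candidate `π x` on `u`. -/
def relabel {m : ℕ} (π : Equiv.Perm (Fin m)) (u : Valuation m) : Valuation m :=
  ⟨u ∘ π, u.2.1.comp π.injective, fun j => u.2.2.1 (π j), by
    rw [π.surjective.range_comp]; exact u.2.2.2⟩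

theorem relabel_comp_relabel {m n : ℕ} (π σ : Equiv.Perm (Fin m)) (u : Profile m n) :
    relabel π ∘ relabel σ ∘ u = relabel (σ * π) ∘ u :=
  rfl

theorem welfare_relabel {m n : ℕ} (π : Equiv.Perm (Fin m)) (u : Profile m n) :
    welfare (relabel π ∘ u) = welfare u ∘ π :=
  rfl

/-- Neutral mechanisms: renaming the candidates on all ballots renames them in the lottery. -/
def Neutral {m n : ℕ} (J : Mechanism m n) : Prop :=
  ∀ (π : Equiv.Perm (Fin m)) (u : Profile m n) (x : Fin m),
    (J (relabel π ∘ u)).1 x = (J u).1 (π x)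

/-- The mechanism that renames the candidates by a uniformly random permutation, runs `J`, and
undoes the renaming. -/
def neutralize {m n : ℕ} (J : Mechanism m n) : Mechanism m n := fun u =>
  ⟨fun x => 𝔼 π : Equiv.Perm (Fin m), (J (relabel π ∘ u)).1 (π⁻¹ x),
    fun x => Finset.expect_nonneg fun π _ => (J (relabel π ∘ u)).2.1 (π⁻¹ x), by
      rw [← Finset.expect_sum_comm]
      simp only [fun π : Equiv.Perm (Fin m) =>
        (Equiv.sum_comp π⁻¹ (J (relabel π ∘ u)).1).trans (J (relabel π ∘ u)).2.2]
      exact Fintype.expect_const 1⟩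

theorem expect_neutralize {m n : ℕ} (J : Mechanism m n) (u : Profile m n) (w : Fin m → ℝ) :
    expect (neutralize J u) w =
      𝔼 π : Equiv.Perm (Fin m), expect (J (relabel π ∘ u)) (w ∘ π) := by
  simp only [expect, neutralize, Finset.expect_mul, ← Finset.expect_sum_comm]
  refine Finset.expect_congr rfl fun π _ => ?_
  rw [← Equiv.sum_comp π]
  simp

theorem neutral_neutralize {m n : ℕ} (J : Mechanism m n) : Neutral (neutralize J) := by
  intro π u x
  simp only [neutralize, relabel_comp_relabel]
  exact Fintype.expect_equiv (Equiv.mulLeft π) _ _ fun σ => by simp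

theorem Truthful.neutralize {m n : ℕ} {J : Mechanism m n} (hJ : Truthful J) :
    Truthful (neutralize J) := by
  intro i u v
  rw [expect_neutralize, expect_neutralize]
  refine Finset.expect_le_expect fun π _ => ?_
  rw [Function.comp_update]
  exact hJ i (relabel π ∘ u) (relabel π v)

theorem Ordinal.neutralize {m n : ℕ} {J : Mechanism m n} (hJ : Ordinal J) :
    Ordinal (neutralize J) := by
  intro i u v h
  refine Subtype.ext (funext fun x => Finset.expect_congr rfl fun π _ => ?_)
  rw [Function.comp_update, hJ i (relabel π ∘ u) (relabel π v) fun j k => h (π j) (π k)]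

theorem ratio_le_ratio_neutralize {m n : ℕ} [NeZero m] [NeZero n] [Nonempty (Valuation m)]
    (J : Mechanism m n) : ratio J ≤ ratio (neutralize J) := by
  refine le_ratio fun u π _ => ?_
  rw [expect_neutralize]
  refine Finset.le_expect Finset.univ_nonempty fun σ _ => ?_
  have h := ratio_mul_welfare_le J (relabel σ ∘ u) (σ⁻¹ (π 0))
  simpa [welfare_relabel] using h

/-- The ranking `0, 1, 2` of three candidates (`a = 0`, `b = 1`, `c = 2`). Like the other rankings
below, it is the permutation that sends each candidate to its position. -/
abbrev abc : Equiv.Perm (Fin 3) := 1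

/-- The ranking `0, 2, 1`. -/
abbrev acb : Equiv.Perm (Fin 3) := Equiv.swap 1 2

/-- The ranking `1, 0, 2`. -/
abbrev bac : Equiv.Perm (Fin 3) := Equiv.swap 0 1

/-- The ranking `1, 2, 0`. -/
abbrev bca : Equiv.Perm (Fin 3) := (finRotate 3)⁻¹

/-- The ranking `2, 0, 1`. -/
abbrev cab : Equiv.Perm (Fin 3) := finRotate 3

/-- The ranking `2, 1, 0`. -/
abbrev cba : Equiv.Perm (Fin 3) := Equiv.swap 0 2

theorem lottery_sum_three (p : Lottery 3) : p.1 0 + p.1 1 + p.1 2 = 1 := by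
  rw [← Fin.sum_univ_three, p.2.2]

section

variable {n : ℕ} {J : Mechanism 3 n}

theorem Truthful.apply_ballot_congr (hT : Truthful J) (hJ : Ordinal J)
    {S T : Fin n → Equiv.Perm (Fin 3)} {x : Fin 3} (h : ∀ i y, S i y < S i x ↔ T i y < T i x) :
    (J (ballot ∘ S)).1 x = (J (ballot ∘ T)).1 x :=
  hT.apply_eq_of_sameAbove hJ fun i y => by
    simpa only [Function.comp_apply, ballot_lt_ballot_iff] using (h i y).symm

theorem Truthful.apply_ballot_comp_congr (hT : Truthful J) (hJ : Ordinal J) {κ : Type*}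
    (R : Fin n → κ) {θ φ : κ → Equiv.Perm (Fin 3)} {x : Fin 3}
    (h : ∀ k y, θ k y < θ k x ↔ φ k y < φ k x) :
    (J (ballot ∘ θ ∘ R)).1 x = (J (ballot ∘ φ ∘ R)).1 x :=
  hT.apply_ballot_congr hJ fun i => h (R i)

theorem Truthful.apply_ballot_update_congr (hT : Truthful J) (hJ : Ordinal J) {κ : Type*}
    (R : Fin n → κ) (i : Fin n) {θ φ : κ → Equiv.Perm (Fin 3)} {σ τ : Equiv.Perm (Fin 3)}
    {x : Fin 3} (h : ∀ k y, θ k y < θ k x ↔ φ k y < φ k x) (hi : ∀ y, σ y < σ x ↔ τ y < τ x) :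
    (J (ballot ∘ Function.update (θ ∘ R) i σ)).1 x =
      (J (ballot ∘ Function.update (φ ∘ R) i τ)).1 x := by
  refine hT.apply_ballot_congr hJ fun l y => ?_
  obtain rfl | hl := eq_or_ne l i
  · simpa only [Function.update_self] using hi y
  · simpa only [Function.update_of_ne hl, Function.comp_apply] using h (R l) y

theorem Neutral.apply_ballot (hN : Neutral J) (S : Fin n → Equiv.Perm (Fin 3))
    (π : Equiv.Perm (Fin 3)) (x : Fin 3) :
    (J (ballot ∘ S)).1 (π x) = (J (ballot ∘ fun i => S i * π)).1 x :=
  (hN π (ballot ∘ S) x).symm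

/-- Candidate `0` is last on both ballots, so its probability is the same. -/
theorem Truthful.apply_bca_sub_apply_cba (hT : Truthful J) (hJ : Ordinal J)
    (S : Fin n → Equiv.Perm (Fin 3)) (i : Fin n) :
    (J (ballot ∘ Function.update S i bca)).1 1 - (J (ballot ∘ Function.update S i cba)).1 1 =
      (J (ballot ∘ Function.update S i cba)).1 2 - (J (ballot ∘ Function.update S i bca)).1 2 := by
  have hzero : (J (ballot ∘ Function.update S i bca)).1 0 =
      (J (ballot ∘ Function.update S i cba)).1 0 :=
    hT.apply_ballot_update_congr hJ S i (θ := id) (φ := id) (fun _ _ => Iff.rfl) (by decide)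
  linarith [lottery_sum_three (J (ballot ∘ Function.update S i bca)),
    lottery_sum_three (J (ballot ∘ Function.update S i cba))]

theorem Truthful.apply_middle_update (hT : Truthful J) (hJ : Ordinal J) (hN : Neutral J)
    (R : Fin n → Fin 2) (i : Fin n) :
    (J (ballot ∘ ![abc, cba] ∘ Function.update R i 1)).1 1 =
      (J (ballot ∘ ![abc, cba] ∘ Function.update R i 0)).1 1 := by
  let P (θ : Fin 2 → Equiv.Perm (Fin 3)) (σ : Equiv.Perm (Fin 3)) : Fin 3 → ℝ :=
    (J (ballot ∘ Function.update (θ ∘ R) i σ)).1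
  -- The swap from `cba` to `bca` changes the probabilities of `1` and `2` by opposite amounts, so
  -- this amount survives changing the other ballots without affecting the sets above `1`, or those
  -- above `2`. Two such changes lead to a renaming of the original ballots.
  have hswap : ∀ θ, P θ bca 1 - P θ cba 1 = P θ cba 2 - P θ bca 2 := fun θ =>
    hT.apply_bca_sub_apply_cba hJ (θ ∘ R) i
  have htwo : ∀ σ, P ![abc, cba] σ 2 = P ![bac, cab] σ 2 := fun σ =>
    hT.apply_ballot_update_congr hJ R i (by decide) fun _ => Iff.rfl
  have hone : ∀ σ, P ![bac, cab] σ 1 = P ![bca, acb] σ 1 := fun σ =>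
    hT.apply_ballot_update_congr hJ R i (by decide) fun _ => Iff.rfl
  have hrename : ∀ σ, P ![bca, acb] σ 2 = P ![abc, cba] (σ * cab) 1 := fun σ => by
    refine (hN.apply_ballot _ cab 1).trans ?_
    refine congrArg (fun S => (J (ballot ∘ S)).1 1) (funext fun l => ?_)
    obtain rfl | hl := eq_or_ne l i
    · simp only [Function.update_self]
    · simp only [Function.update_of_ne hl, Function.comp_apply]
      generalize R l = k
      decide +revert
  have hbac : P ![abc, cba] bac 1 = P ![abc, cba] bca 1 :=
    hT.apply_ballot_update_congr hJ R i (fun _ _ => Iff.rfl) (by decide)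
  have hcba : P ![bca, acb] cba 2 = P ![abc, cba] bac 1 :=
    (hrename cba).trans (congrArg (P _ · 1) (by decide))
  have hbca : P ![bca, acb] bca 2 = P ![abc, cba] abc 1 :=
    (hrename bca).trans (congrArg (P _ · 1) (by decide))
  simp only [Function.comp_update ![abc, cba]]
  change P ![abc, cba] cba 1 = P ![abc, cba] abc 1
  linarith [hswap ![abc, cba], hswap ![bac, cab], hswap ![bca, acb], htwo cba, htwo bca, hone cba,
    hone bca]

theorem Truthful.apply_middle_eq (hT : Truthful J) (hJ : Ordinal J) (hN : Neutral J)
    (R R' : Fin n → Fin 2) :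
    (J (ballot ∘ ![abc, cba] ∘ R)).1 1 = (J (ballot ∘ ![abc, cba] ∘ R')).1 1 := by
  have hconst : ∀ (R : Fin n → Fin 2) i k,
      (J (ballot ∘ ![abc, cba] ∘ Function.update R i k)).1 1 =
        (J (ballot ∘ ![abc, cba] ∘ Function.update R i 0)).1 1 := fun R i =>
    Fin.forall_fin_two.2 ⟨rfl, hT.apply_middle_update hJ hN R i⟩
  refine eq_of_forall_update (r := fun _ _ => True)
    (F := fun R : Fin n → Fin 2 => (J (ballot ∘ ![abc, cba] ∘ R)).1 1)
    (fun i R k _ => ?_) fun _ => trivial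
  have h := hconst R i (R i)
  rw [Function.update_eq_self] at h
  exact (hconst R i k).trans h.symm

theorem approvalScore_ballot {κ : Type*} [Fintype κ] {f : Fin n → κ} {t : κ → ℕ}
    (hf : ∀ g : κ → ℝ, ∑ i, g (f i) = ∑ l, t l * g l) (k : ℕ) (θ : κ → Equiv.Perm (Fin 3))
    (x : Fin 3) :
    approvalScore k (ballot ∘ θ ∘ f) x = ∑ l, t l * if (θ l x : ℕ) < k then (1 : ℝ) else 0 := by
  simp only [approvalScore, Function.comp_apply, approval_ballot]
  exact hf fun l => if (θ l x : ℕ) < k then 1 else 0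

variable [NeZero n]

theorem Ordinal.ratio_mul_sum_le (hJ : Ordinal J) {κ : Type*} [Fintype κ] {f : Fin n → κ}
    {t : κ → ℕ} (hf : ∀ g : κ → ℝ, ∑ i, g (f i) = ∑ l, t l * g l) (θ : κ → Equiv.Perm (Fin 3))
    {k : ℕ} (hk : k ∈ Set.Ioo 0 3) (x : Fin 3) :
    ratio J * ∑ l, t l * (if (θ l x : ℕ) < k then (1 : ℝ) else 0) ≤
      ∑ j, (J (ballot ∘ θ ∘ f)).1 j * ∑ l, t l * if (θ l j : ℕ) < k then (1 : ℝ) else 0 := by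
  simpa only [expect, approvalScore_ballot hf] using
    hJ.ratio_mul_approvalScore_le hk (ballot ∘ θ ∘ f) x

/-- The sizes of the four groups of voters in the three profiles of the bound `77 / 117` for
ordinal mechanisms. The groups are chosen so that every member of a group has the same ballot in
each profile, and `d` is the remainder of the number of voters modulo `26`. -/
def groupSize (q d : ℕ) : Fin 4 → ℕ := ![7 * q, 6 * q, q + d, 12 * q]

variable {q d : ℕ} {f : Fin n → Fin 4}

theorem Ordinal.ratio_mul_le_middle (hJ : Ordinal J)
    (hf : ∀ g : Fin 4 → ℝ, ∑ i, g (f i) = ∑ l, groupSize q d l * g l) :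
    26 * (ratio J * q) ≤
      13 * q + 13 * ((J (ballot ∘ ![abc, abc, cba, cba] ∘ f)).1 1 * q) + d := by
  set p := J (ballot ∘ ![abc, abc, cba, cba] ∘ f) with hp
  have hbound : ratio J * (26 * q + d) ≤
      p.1 0 * (13 * q) + p.1 1 * (26 * q + d) + p.1 2 * (13 * q + d) := by
    have h := hJ.ratio_mul_sum_le hf ![abc, abc, cba, cba] (k := 2) (by norm_num) 1
    simp +decide [← hp, groupSize, Fin.sum_univ_succ] at h
    linarith
  have hd : (0 : ℝ) ≤ d := d.cast_nonneg
  linear_combination hbound + (13 * q + d) * lottery_sum_three p +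
    mul_nonneg (ratio_nonneg J) hd + mul_nonneg (p.2.1 0) hd

theorem Ordinal.ratio_mul_le_front (hJ : Ordinal J)
    (hf : ∀ g : Fin 4 → ℝ, ∑ i, g (f i) = ∑ l, groupSize q d l * g l) :
    14 * (ratio J * q) ≤
      14 * q - 14 * ((J (ballot ∘ ![abc, abc, abc, cba] ∘ f)).1 1 * q) -
        2 * ((J (ballot ∘ ![abc, abc, abc, cba] ∘ f)).1 2 * q) + d := by
  set p := J (ballot ∘ ![abc, abc, abc, cba] ∘ f) with hp
  have hbound : ratio J * (14 * q + d) ≤ p.1 0 * (14 * q + d) + p.1 2 * (12 * q) := by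
    have h := hJ.ratio_mul_sum_le hf ![abc, abc, abc, cba] (k := 1) (by norm_num) 0
    simp +decide [← hp, groupSize, Fin.sum_univ_succ] at h
    linarith
  have hd : (0 : ℝ) ≤ d := d.cast_nonneg
  linear_combination hbound + (14 * q + d) * lottery_sum_three p +
    mul_nonneg (ratio_nonneg J) hd + mul_nonneg (p.2.1 1) hd + mul_nonneg (p.2.1 2) hd

theorem Ordinal.ratio_mul_le_bottom (hJ : Ordinal J)
    (hf : ∀ g : Fin 4 → ℝ, ∑ i, g (f i) = ∑ l, groupSize q d l * g l) :
    12 * (ratio J * q) ≤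
      7 * q + 5 * ((J (ballot ∘ ![abc, bac, bac, cba] ∘ f)).1 2 * q) + d := by
  set p := J (ballot ∘ ![abc, bac, bac, cba] ∘ f) with hp
  have hbound : ratio J * (12 * q) ≤
      p.1 0 * (7 * q) + p.1 1 * (7 * q + d) + p.1 2 * (12 * q) := by
    have h := hJ.ratio_mul_sum_le hf ![abc, bac, bac, cba] (k := 1) (by norm_num) 2
    simp +decide [← hp, groupSize, Fin.sum_univ_succ] at h
    linarith
  have hd : (0 : ℝ) ≤ d := d.cast_nonneg
  linear_combination hbound + (7 * q + d) * lottery_sum_three p +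
    mul_nonneg (p.2.1 0) hd + mul_nonneg (p.2.1 2) hd

theorem Truthful.ratio_mul_le_of_neutral (hT : Truthful J) (hJ : Ordinal J) (hN : Neutral J)
    (hn : n = 26 * q + d) : 117 * (ratio J * q) ≤ 77 * q + 7 * d := by
  obtain ⟨f, hf⟩ := exists_sum_comp_eq (t := groupSize q d) (n := n) <| by
    simp only [groupSize, Fin.sum_univ_four, Matrix.cons_val]
    omega
  have hmiddle : (J (ballot ∘ ![abc, abc, cba, cba] ∘ f)).1 1 =
      (J (ballot ∘ ![abc, abc, abc, cba] ∘ f)).1 1 := by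
    have hhalf : ![abc, abc, cba, cba] = ![abc, cba] ∘ ![0, 0, 1, 1] := by decide
    have hfront : ![abc, abc, abc, cba] = ![abc, cba] ∘ ![0, 0, 0, 1] := by decide
    rw [hhalf, hfront]
    exact hT.apply_middle_eq hJ hN (![0, 0, 1, 1] ∘ f) (![0, 0, 0, 1] ∘ f)
  have hlast : (J (ballot ∘ ![abc, bac, bac, cba] ∘ f)).1 2 =
      (J (ballot ∘ ![abc, abc, abc, cba] ∘ f)).1 2 :=
    hT.apply_ballot_comp_congr hJ f (by decide)
  have hhalf_le := hJ.ratio_mul_le_middle hf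
  have hfront_le := hJ.ratio_mul_le_front hf
  have hbottom_le := hJ.ratio_mul_le_bottom hf
  rw [hmiddle] at hhalf_le
  rw [hlast] at hbottom_le
  linarith

end

theorem Truthful.ratio_le_of_ordinal {n : ℕ} [NeZero n] {J : Mechanism 3 n} (hT : Truthful J)
    (hJ : Ordinal J) (hn : 52000 ≤ n) : ratio J ≤ 659 / 1000 := by
  have h := hT.neutralize.ratio_mul_le_of_neutral hJ.neutralize (neutral_neutralize J)
    (Nat.div_add_mod n 26).symm
  have hq : (2000 : ℝ) ≤ (n / 26 : ℕ) := mod_cast (by omega)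
  have hd : ((n % 26 : ℕ) : ℝ) ≤ 25 := mod_cast (by omega)
  refine (ratio_le_ratio_neutralize J).trans ?_
  nlinarith

end Voting

end

theorem mainTheorem4 :
    Tendsto (fun k : ℕ => Voting.ratio (Voting.quadraticLottery (k + 1))) atTop
      (𝓝 ((√5 - 1) / 2)) ∧
    (∀ (n : ℕ) [NeZero n], Voting.Truthful (Voting.mixedMechanism n) ∧
      33 / 50 < Voting.ratio (Voting.mixedMechanism n)) ∧
    (∃ δ : ℝ, 0 < δ ∧ ∃ N : ℕ, ∀ (n : ℕ) [NeZero n], N ≤ n →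
      ∀ J : Voting.Mechanism 3 n, Voting.Truthful J → Voting.Ordinal J →
        Voting.ratio J + δ ≤ Voting.ratio (Voting.mixedMechanism n)) := by
  refine ⟨Voting.tendsto_ratio_quadraticLottery, fun n _ =>
    ⟨Voting.truthful_mixedMechanism n, Voting.lt_ratio_mixedMechanism n⟩,
    1 / 1000, by norm_num, 52000, fun n _ hn J hT hJ => ?_⟩
  linarith [hT.ratio_le_of_ordinal hJ hn, Voting.lt_ratio_mixedMechanism n]
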